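/- Bimodal formulas are built from countably many propositional variables $\mathsf P_0,\mathsf P_1,\dots$ using $\neg$, $\land$, $\Diamond_0$, $\Diamond_1$. They are interpreted in the usual Kripke semantics over 2-frames $\langle W,R_0,R_1\rangle$ ($W\neq\emptyset$, $R_0,R_1\subseteq W\times W$), where $\Diamond_i$ is read along $R_i$. An expanding 2-frame with horizontal component $\langle\omega,<\rangle$ and difference vertical components is given by non-empty sets $W_0\subseteq W_1\subseteq W_2\subseteq\cdots$: its set of worlds is $\{\langle n,v\rangle : n\in\omega,\ v\in W_n\}$, and $$\langle n,v\rangle R_0\langle n',v'\rangle \iff n<n' \text{ and } v=v',\qquad \langle n,v\rangle R_1\langle n',v'\rangle\iff n=n'\text{ and } v\ne v'.$$ Let $\{\langle\omega,<\rangle\}\times^{e}\mathcal C_{\mathrm{diff}}$ be the class of all these 2-frames. \textbf{Theorem.} $\{\langle\omega,<\rangle\}\times^{e}\mathcal C_{\mathrm{diff}}$-satisfiability is co-r.e.; that is, the set of (codes of) those bimodal formulas that are not true at any world of any model based on a 2-frame in this class is recursively enumerable. -/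

import Mathlib

universe u v

namespace Bimodal

/-- Bimodal formulas over the propositional variables `P₀, P₁, P₂, …`. -/
inductive Formula : Type
  | var : ℕ → Formula
  | neg : Formula → Formula
  | and : Formula → Formula → Formula
  | dia0 : Formula → Formula
  | dia1 : Formula → Formula

namespace Formula

/-- An explicit Gödel numbering of the bimodal formulas. -/
def toNat : Formula → ℕ
  | var n => 5 * n
  | neg φ => 5 * toNat φ + 1
  | and φ ψ => 5 * Nat.pair (toNat φ) (toNat ψ) + 2
  | dia0 φ => 5 * toNat φ + 3
  | dia1 φ => 5 * toNat φ + 4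

theorem toNat_injective : Function.Injective toNat := by
  intro φ
  induction φ with
  | var n => intro ψ h; cases ψ <;> simp only [toNat] at h <;> first | omega | (congr 1; omega)
  | neg φ ih =>
    intro ψ h
    cases ψ <;> simp only [toNat] at h <;> first | omega | (congr 1; exact ih (by omega))
  | and φ χ ih1 ih2 =>
    intro ψ h
    cases ψ <;> simp only [toNat] at h <;> first
      | omega
      | (have h2 := Nat.pair_eq_pair.1 (Nat.eq_of_mul_eq_mul_left (by norm_num : 0 < 5)
           (Nat.add_right_cancel h))
         congr 1
         · exact ih1 h2.1
         · exact ih2 h2.2)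
  | dia0 φ ih =>
    intro ψ h
    cases ψ <;> simp only [toNat] at h <;> first | omega | (congr 1; exact ih (by omega))
  | dia1 φ ih =>
    intro ψ h
    cases ψ <;> simp only [toNat] at h <;> first | omega | (congr 1; exact ih (by omega))

theorem toNat_surjective : Function.Surjective toNat := by
  intro n
  induction n using Nat.strong_induction_on with
  | _ n ih =>
    have hr : n % 5 < 5 := Nat.mod_lt _ (by norm_num)
    by_cases h0 : n % 5 = 0
    · exact ⟨var (n / 5), by simp only [toNat]; omega⟩
    · have hlt : n / 5 < n := by omega
      obtain ⟨φ, hφ⟩ := ih (n / 5) hlt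
      obtain ⟨α, hα⟩ := ih (n / 5).unpair.1 (lt_of_le_of_lt (Nat.unpair_left_le _) hlt)
      obtain ⟨β, hβ⟩ := ih (n / 5).unpair.2 (lt_of_le_of_lt (Nat.unpair_right_le _) hlt)
      have hc : n % 5 = 1 ∨ n % 5 = 2 ∨ n % 5 = 3 ∨ n % 5 = 4 := by omega
      rcases hc with h | h | h | h
      · exact ⟨neg φ, by simp only [toNat]; omega⟩
      · exact ⟨and α β, by simp only [toNat, hα, hβ, Nat.pair_unpair]; omega⟩
      · exact ⟨dia0 φ, by simp only [toNat]; omega⟩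
      · exact ⟨dia1 φ, by simp only [toNat]; omega⟩

/-- Formulas are coded by natural numbers through the bijection `toNat`; computability of
predicates on formulas refers to this coding. -/
noncomputable instance : Denumerable Formula :=
  Denumerable.mk' (Equiv.ofBijective toNat ⟨toNat_injective, toNat_surjective⟩)

end Formula

/-- A 2-frame: a non-empty set of worlds with two binary relations. -/
structure TwoFrame where
  World : Type u
  nonempty : Nonempty World
  R0 : World → World → Prop
  R1 : World → World → Prop

/-- A valuation on a 2-frame; a 2-frame with a valuation is a model based on the frame. -/
abbrev TwoFrame.Valuation (H : TwoFrame.{u}) : Type u := ℕ → Set H.World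

/-- Truth of a formula at a world of the model `(H, ν)`. -/
def TwoFrame.Truth (H : TwoFrame.{u}) (ν : H.Valuation) : H.World → Formula → Prop
  | w, .var p => w ∈ ν p
  | w, .neg φ => ¬ H.Truth ν w φ
  | w, .and φ ψ => H.Truth ν w φ ∧ H.Truth ν w ψ
  | w, .dia0 φ => ∃ w', H.R0 w w' ∧ H.Truth ν w' φ
  | w, .dia1 φ => ∃ w', H.R1 w w' ∧ H.Truth ν w' φ

/-- `φ` is `C`-satisfiable: satisfied in a model based on some 2-frame of the class `C`. -/
def Satisfiable (C : Set TwoFrame.{u}) (φ : Formula) : Prop :=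
  ∃ H ∈ C, ∃ ν : H.Valuation, ∃ w : H.World, H.Truth ν w φ

/-- A (unimodal) frame `⟨W, R⟩` whose worlds are taken from the type `U`: a non-empty set `W`
with a relation `R ⊆ W × W`. -/
structure Frame (U : Type u) where
  carrier : Set U
  nonempty : carrier.Nonempty
  rel : U → U → Prop
  rel_mem : ∀ x y, rel x y → x ∈ carrier ∧ y ∈ carrier

/-- `F` is a subframe of `G`: the worlds of `F` are worlds of `G`, and the relation of `F` is the
restriction of that of `G`. -/
def Frame.IsSubframe {U : Type u} (F G : Frame U) : Prop :=
  F.carrier ⊆ G.carrier ∧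
    ∀ x y, F.rel x y ↔ G.rel x y ∧ x ∈ F.carrier ∧ y ∈ F.carrier

/-- Classes of frames. -/
abbrev FrameClass : Type (u + 1) := Set (Σ U : Type u, Frame U)

/-- The 2-frame on `{⟨u, v⟩ : u ∈ F, v ∈ G u}` given by a horizontal frame `F` and a family of
vertical frames `G u`, for `u` in `F`. -/
def frameSum {U : Type u} {V : Type v} (F : Frame U) (G : F.carrier → Frame V) :
    TwoFrame.{max u v} where
  World := Σ x : F.carrier, (G x).carrier
  nonempty := ⟨⟨⟨F.nonempty.some, F.nonempty.some_mem⟩, ⟨_, (G _).nonempty.some_mem⟩⟩⟩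
  R0 p q := F.rel p.1 q.1 ∧ (p.2 : V) = q.2
  R1 p q := (G p.1).rel p.2 q.2 ∧ p.1 = q.1

/-- The class `C₀ ×ᵉ C₁` of expanding 2-frames with horizontal frame in `C₀` and vertical frames
in `C₁`. -/
def expandingProduct (C0 : FrameClass.{u}) (C1 : FrameClass.{v}) : Set TwoFrame.{max u v} :=
  {H | ∃ (U : Type u) (V : Type v) (F : Frame U) (G : F.carrier → Frame V),
    (∀ x y : F.carrier, F.rel x y → (G x).IsSubframe (G y)) ∧
    ⟨U, F⟩ ∈ C0 ∧ (∀ x, ⟨V, G x⟩ ∈ C1) ∧ H = frameSum F G}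

/-- The frame `⟨ω, <⟩`. -/
def omegaFrame : Frame ℕ where
  carrier := Set.univ
  nonempty := Set.univ_nonempty
  rel x y := x < y
  rel_mem _ _ _ := ⟨trivial, trivial⟩

/-- The class `C_diff` of all difference frames `⟨W, ≠⟩`. -/
def diffFrames : FrameClass.{u} :=
  {F | ∀ x ∈ F.2.carrier, ∀ y ∈ F.2.carrier, F.2.rel x y ↔ x ≠ y}

/-- A predicate is co-r.e. if its complement is recursively enumerable. -/
def CoREPred {α : Type u} [Primcodable α] (p : α → Prop) : Prop :=
  REPred fun a => ¬ p a

end Bimodal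

/-! A label records which formulas of small code hold at a point and which `◇₀`-promises are pending
there; finitely many points of a vertical component yield a multiset of labels. By
`exists_witnesses`, two witnesses per `◇₁`-argument suffice. Satisfiability amounts to an infinite
run of such multisets with infinitely many renewals, moments at which nothing is pending and the
current promises are recorded afresh (a Büchi condition).

Since domains expand, points can be forgotten: whatever they turn into later counts as newly born.
So `Passes M m`, the possibility of `m` renewals, is inherited by sub-multisets. Multiset inclusion
over a finite alphabet is a well-quasi-order; hence these sets become stable at some level `n`
(`exists_passes_succ`), where runs can be built (`exists_run`), and at each level the failing
multisets have a finite basis. If no run makes the formula true, the bases of levels `0, …, n` form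
a certificate (`exists_certifies`). Conversely, following points of a model through a certificate
would give an infinite descent of levels (`not_certified`).

Checking a certificate is primitive recursive, because only extensions by boundedly many points are
examined; so having one is an r.e. property. -/

namespace PrimrecPred

/-! ### Closure properties of primitive recursive predicates -/

variable {α β : Type*} [Primcodable α] [Primcodable β]

theorem imp {p q : α → Prop} (hp : PrimrecPred p) (hq : PrimrecPred q) :
    PrimrecPred fun a => p a → q a :=
  (hp.not.or hq).of_eq fun _ => by tauto

theorem iff {p q : α → Prop} (hp : PrimrecPred p) (hq : PrimrecPred q) :
    PrimrecPred fun a => p a ↔ q a :=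
  ((hp.imp hq).and (hq.imp hp)).of_eq fun _ => by tauto

theorem ball {f : α → List β} {p : α → β → Prop} (hf : Primrec f)
    (hp : PrimrecPred fun x : α × β => p x.1 x.2) : PrimrecPred fun a => ∀ b ∈ f a, p a b :=
  (PrimrecRel.forall_mem_list (R := fun b a => p a b)
    (hp.comp (Primrec.pair Primrec.snd Primrec.fst))).comp hf Primrec.id

theorem bex {f : α → List β} {p : α → β → Prop} (hf : Primrec f)
    (hp : PrimrecPred fun x : α × β => p x.1 x.2) : PrimrecPred fun a => ∃ b ∈ f a, p a b :=
  (PrimrecRel.exists_mem_list (R := fun b a => p a b)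
    (hp.comp (Primrec.pair Primrec.snd Primrec.fst))).comp hf Primrec.id

theorem ball_lt {f : α → ℕ} {p : α → ℕ → Prop} (hf : Primrec f)
    (hp : PrimrecPred fun x : α × ℕ => p x.1 x.2) : PrimrecPred fun a => ∀ k < f a, p a k :=
  (ball (Primrec.list_range.comp hf) hp).of_eq fun _ => by simp

/-- The projection of a primitive recursive relation is recursively enumerable. -/
theorem rePred_exists {p : α → β → Prop} (hp : PrimrecPred fun x : α × β => p x.1 x.2) :
    REPred fun a => ∃ b, p a b := by
  classical
  -- Numbers that code no element of `β` count as failures, so the unbounded search stops only at a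
  -- genuine witness.
  let q : α → ℕ → Bool := fun a n =>
    ((Encodable.decode n : Option β).map fun b => decide (p a b)).getD false
  have hq : Primrec₂ q :=
    Primrec.option_getD.comp (Primrec.option_map (Primrec.decode.comp Primrec.snd)
      (hp.decide.comp (Primrec.pair (Primrec.fst.comp Primrec.fst) Primrec.snd)))
      (Primrec.const false)
  have h : Partrec fun a => Nat.rfind fun n => Part.some (q a n) :=
    Partrec.rfind hq.to_comp.partrec
  refine h.dom_re.of_eq fun a => ?_
  refine Nat.rfind_dom.trans ?_
  constructor
  · rintro ⟨n, hn, -⟩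
    simp only [Part.mem_some_iff, q] at hn
    cases hd : (Encodable.decode n : Option β) with
    | none => simp [hd] at hn
    | some b => exact ⟨b, by simpa [hd] using hn⟩
  · rintro ⟨b, hb⟩
    exact ⟨Encodable.encode b, by simpa [q] using hb, fun _ => trivial⟩

end PrimrecPred

namespace Primrec

variable {α : Type*} [Primcodable α]

theorem nat_pow : Primrec₂ ((· ^ ·) : ℕ → ℕ → ℕ) :=
  Primrec₂.unpaired'.1 Nat.Primrec.pow

theorem list_count [DecidableEq α] : Primrec₂ fun (a : α) (l : List α) => l.count a :=
  (list_length.comp ((PrimrecRel.listFilter (R := fun b a : α => b = a) Primrec.eq).comp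
    snd fst)).of_eq fun x => by
      simp only [List.count_eq_countP, List.countP_eq_length_filter]; rfl

end Primrec

/-! ### Labels, moves and certificates -/

namespace Bimodal.Sat

/-- All words of length at most `n` over the alphabet `{0, …, A - 1}`. -/
def words (A : ℕ) : ℕ → List (List ℕ)
  | 0 => [[]]
  | n + 1 => [] :: (words A n).flatMap fun l => (List.range A).map fun a => a :: l

theorem mem_words {A n : ℕ} {l : List ℕ} : l ∈ words A n ↔ l.length ≤ n ∧ ∀ a ∈ l, a < A := by
  induction n generalizing l with
  | zero => cases l <;> simp [words]
  | succ n ih =>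
    cases l with
    | nil => simp [words]
    | cons a l => simp [words, ih]; tauto

theorem primrec_words : Primrec₂ words := by
  have h : Primrec₂ fun (A n : ℕ) => (Nat.rec [[]] (fun _ w => [] :: w.flatMap fun l =>
      (List.range A).map fun a => a :: l) n : List (List ℕ)) := by
    refine Primrec.nat_rec (f := fun _ => [[]]) (g := fun A p => [] :: p.2.flatMap fun l =>
      (List.range A).map fun a => a :: l) (Primrec.const _) ?_
    refine Primrec.list_cons.comp (Primrec.const []) ?_
    refine Primrec.list_flatMap (Primrec.snd.comp Primrec.snd) ?_
    refine Primrec.list_map (Primrec.list_range.comp (Primrec.fst.comp Primrec.fst)) ?_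
    exact Primrec.list_cons.comp Primrec.snd (Primrec.snd.comp Primrec.fst)
  refine h.of_eq fun A n => ?_
  induction n with
  | zero => rfl
  | succ n ih => simp only [words]; rw [← ih]

/-- The formula with code `k` belongs to the type coded by the label `a`. -/
def Holds (a k : ℕ) : Prop := a.testBit (2 * k) = true

/-- The label `a` records that the formula with code `k` still has to be made true. -/
def Pending (a k : ℕ) : Prop := a.testBit (2 * k + 1) = true

/-- The list of labels `E` is the list of types of the worlds of some vertical component, as far as
formulas with code less than `5 * M` are concerned. -/
def Coherent (M : ℕ) (E : List ℕ) : Prop :=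
  ∀ a ∈ E, a < 2 ^ (10 * M) ∧ ∀ k < M,
    (Holds a (5 * k + 1) ↔ ¬ Holds a k) ∧
    (Holds a (5 * k + 2) ↔ Holds a k.unpair.1 ∧ Holds a k.unpair.2) ∧
    (Holds a (5 * k + 4) ↔ ∃ b ∈ E, Holds b k ∧ (b ≠ a ∨ 2 ≤ E.count a))

/-- The label `b` may follow the label `a` along `ω`. -/
def Next (M a b : ℕ) : Prop :=
  ∀ k < M, Holds a (5 * k + 3) ↔ Holds b k ∨ Holds b (5 * k + 3)

/-- `b` may follow `a`, and keeps the pending formulas of `a` that `b` does not make true. -/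
def Keep (M a b : ℕ) : Prop :=
  Next M a b ∧ ∀ k < M, Pending a k → Holds b k ∨ Pending b k

/-- `b` may follow `a`, nothing is pending in `a`, and in `b` everything becomes pending that `a`
requires and `b` does not make true. -/
def Renew (M a b : ℕ) : Prop :=
  Next M a b ∧ ∀ k < M, ¬ Pending a k ∧ (Holds a (5 * k + 3) → Holds b k ∨ Pending b k)

/-- The entries of `E` are related to the entries of `F` at the same positions. -/
def Ext (r : ℕ → ℕ → Prop) (E F : List ℕ) : Prop :=
  E.length ≤ F.length ∧ ∀ i < E.length, r (E.getD i 0) (F.getD i 0)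

/-- `E` is contained in `F` as a multiset. -/
def Sub (E F : List ℕ) : Prop := ∀ a ∈ E, E.count a ≤ F.count a

theorem sub_iff {E F : List ℕ} : Sub E F ↔ E.Subperm F := List.subperm_ext_iff.symm

/-- `C` certifies that the formula with code `N` is not satisfiable. -/
def Certifies (N : ℕ) (C : List (ℕ × List ℕ)) : Prop :=
  -- The length bounds are the given points (one at the start, `c.2` later) plus two witnesses for
  -- each of `N + 1` codes; they make the check finite.
  (∀ E ∈ words (2 ^ (10 * (N + 1))) (1 + 2 * (N + 1)), Coherent (N + 1) E →
    (∃ a ∈ E, Holds a N) → ∃ c ∈ C, Sub c.2 E) ∧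
  ∀ c ∈ C, ∀ E ∈ words (2 ^ (10 * (N + 1))) (c.2.length + 2 * (N + 1)), Coherent (N + 1) E →
    (Ext (Keep (N + 1)) c.2 E → ∃ c' ∈ C, c'.1 = c.1 ∧ Sub c'.2 E) ∧
    (Ext (Renew (N + 1)) c.2 E → ∃ c' ∈ C, c'.1 < c.1 ∧ Sub c'.2 E)

/-! ### Certificates can be checked primitive recursively -/

section Computability

variable {α : Type*} [Primcodable α]

theorem primrecPred_testBit {f g : α → ℕ} (hf : Primrec f) (hg : Primrec g) :
    PrimrecPred fun x => (f x).testBit (g x) = true :=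
  (Primrec.eq.comp (Primrec.nat_mod.comp (Primrec.nat_div.comp hf
    (Primrec.nat_pow.comp (Primrec.const 2) hg)) (Primrec.const 2)) (Primrec.const 1)).of_eq
    fun x => by rw [Nat.testBit_eq_decide_div_mod_eq, decide_eq_true_iff]

theorem primrec_mul_add {f : α → ℕ} (c d : ℕ) (hf : Primrec f) : Primrec fun x => c * f x + d :=
  Primrec.nat_add.comp (Primrec.nat_mul.comp (Primrec.const c) hf) (Primrec.const d)

theorem primrecPred_holds {f g : α → ℕ} (hf : Primrec f) (hg : Primrec g) :
    PrimrecPred fun x => Holds (f x) (g x) :=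
  primrecPred_testBit hf (Primrec.nat_mul.comp (Primrec.const 2) hg)

theorem primrecPred_pending {f g : α → ℕ} (hf : Primrec f) (hg : Primrec g) :
    PrimrecPred fun x => Pending (f x) (g x) :=
  primrecPred_testBit hf (primrec_mul_add 2 1 hg)

theorem primrecPred_coherent {f : α → ℕ} {g : α → List ℕ} (hf : Primrec f) (hg : Primrec g) :
    PrimrecPred fun x => Coherent (f x) (g x) := by
  refine PrimrecPred.ball hg (PrimrecPred.and ?_ (PrimrecPred.ball_lt (hf.comp Primrec.fst) ?_))
  · exact Primrec.nat_lt.comp Primrec.snd (Primrec.nat_pow.comp (Primrec.const 2)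
      (Primrec.nat_mul.comp (Primrec.const 10) (hf.comp Primrec.fst)))
  · have ha : Primrec fun x : (α × ℕ) × ℕ => x.1.2 := Primrec.snd.comp Primrec.fst
    have hk : Primrec fun x : (α × ℕ) × ℕ => x.2 := Primrec.snd
    have hE : Primrec fun x : (α × ℕ) × ℕ => g x.1.1 := hg.comp (Primrec.fst.comp Primrec.fst)
    refine PrimrecPred.and ?_ (PrimrecPred.and ?_ ?_)
    · exact (primrecPred_holds ha (primrec_mul_add 5 1 hk)).iff (primrecPred_holds ha hk).not
    · have hu := Primrec.unpair.comp hk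
      exact (primrecPred_holds ha (primrec_mul_add 5 2 hk)).iff
        ((primrecPred_holds ha (Primrec.fst.comp hu)).and
          (primrecPred_holds ha (Primrec.snd.comp hu)))
    · refine (primrecPred_holds ha (primrec_mul_add 5 4 hk)).iff (PrimrecPred.bex hE ?_)
      refine (primrecPred_holds Primrec.snd (hk.comp Primrec.fst)).and (PrimrecPred.or ?_ ?_)
      · exact (Primrec.eq.comp Primrec.snd (ha.comp Primrec.fst)).not
      · exact Primrec.nat_le.comp (Primrec.const 2)
          (Primrec.list_count.comp (ha.comp Primrec.fst) (hE.comp Primrec.fst))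

theorem primrecPred_next {f g h : α → ℕ} (hf : Primrec f) (hg : Primrec g) (hh : Primrec h) :
    PrimrecPred fun x => Next (f x) (g x) (h x) := by
  refine PrimrecPred.ball_lt hf ?_
  have hk := primrec_mul_add (α := α × ℕ) 5 3 Primrec.snd
  exact (primrecPred_holds (hg.comp Primrec.fst) hk).iff
    ((primrecPred_holds (hh.comp Primrec.fst) Primrec.snd).or
      (primrecPred_holds (hh.comp Primrec.fst) hk))

theorem primrecPred_keep {f g h : α → ℕ} (hf : Primrec f) (hg : Primrec g) (hh : Primrec h) :
    PrimrecPred fun x => Keep (f x) (g x) (h x) := by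
  refine (primrecPred_next hf hg hh).and (PrimrecPred.ball_lt hf ?_)
  exact (primrecPred_pending (hg.comp Primrec.fst) Primrec.snd).imp
    ((primrecPred_holds (hh.comp Primrec.fst) Primrec.snd).or
      (primrecPred_pending (hh.comp Primrec.fst) Primrec.snd))

theorem primrecPred_renew {f g h : α → ℕ} (hf : Primrec f) (hg : Primrec g) (hh : Primrec h) :
    PrimrecPred fun x => Renew (f x) (g x) (h x) := by
  refine (primrecPred_next hf hg hh).and (PrimrecPred.ball_lt hf ?_)
  exact (primrecPred_pending (hg.comp Primrec.fst) Primrec.snd).not.and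
    ((primrecPred_holds (hg.comp Primrec.fst) (primrec_mul_add 5 3 Primrec.snd)).imp
    ((primrecPred_holds (hh.comp Primrec.fst) Primrec.snd).or
      (primrecPred_pending (hh.comp Primrec.fst) Primrec.snd)))

theorem primrecPred_ext {r : α → ℕ → ℕ → Prop} {f g : α → List ℕ}
    (hr : PrimrecPred fun x : α × ℕ × ℕ => r x.1 x.2.1 x.2.2) (hf : Primrec f) (hg : Primrec g) :
    PrimrecPred fun x => Ext (r x) (f x) (g x) := by
  refine (Primrec.nat_le.comp (Primrec.list_length.comp hf) (Primrec.list_length.comp hg)).and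
    (PrimrecPred.ball_lt (Primrec.list_length.comp hf) ?_)
  exact hr.comp (Primrec.pair Primrec.fst (Primrec.pair
    ((Primrec.list_getD 0).comp (hf.comp Primrec.fst) Primrec.snd)
    ((Primrec.list_getD 0).comp (hg.comp Primrec.fst) Primrec.snd)))

theorem primrecPred_sub {f g : α → List ℕ} (hf : Primrec f) (hg : Primrec g) :
    PrimrecPred fun x => Sub (f x) (g x) :=
  PrimrecPred.ball hf (Primrec.nat_le.comp
    (Primrec.list_count.comp Primrec.snd (hf.comp Primrec.fst))
    (Primrec.list_count.comp Primrec.snd (hg.comp Primrec.fst)))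

theorem primrecPred_exists_sub {r : ℕ → ℕ → Prop} {C : α → List (ℕ × List ℕ)} {m : α → ℕ}
    {E : α → List ℕ} (hr : PrimrecRel r) (hC : Primrec C) (hm : Primrec m) (hE : Primrec E) :
    PrimrecPred fun x => ∃ c ∈ C x, r c.1 (m x) ∧ Sub c.2 (E x) :=
  PrimrecPred.bex hC ((hr.comp (Primrec.fst.comp Primrec.snd) (hm.comp Primrec.fst)).and
    (primrecPred_sub (Primrec.snd.comp Primrec.snd) (hE.comp Primrec.fst)))

theorem primrec_words_pow {f g : α → ℕ} (hf : Primrec f) (hg : Primrec g) :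
    Primrec fun x => words (2 ^ (10 * (f x + 1))) (g x + 2 * (f x + 1)) :=
  primrec_words.comp (Primrec.nat_pow.comp (Primrec.const 2)
    (Primrec.nat_mul.comp (Primrec.const 10) (Primrec.succ.comp hf)))
    (Primrec.nat_add.comp hg (Primrec.nat_mul.comp (Primrec.const 2) (Primrec.succ.comp hf)))

theorem primrecPred_closed {N : α → ℕ} {C : α → List (ℕ × List ℕ)} {c : α → ℕ × List ℕ}
    {E : α → List ℕ} (hN : Primrec N) (hC : Primrec C) (hc : Primrec c) (hE : Primrec E) :
    PrimrecPred fun x => Coherent (N x + 1) (E x) →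
      (Ext (Keep (N x + 1)) (c x).2 (E x) → ∃ c' ∈ C x, c'.1 = (c x).1 ∧ Sub c'.2 (E x)) ∧
      (Ext (Renew (N x + 1)) (c x).2 (E x) → ∃ c' ∈ C x, c'.1 < (c x).1 ∧ Sub c'.2 (E x)) := by
  have hM := Primrec.succ.comp hN
  have hm := Primrec.fst.comp hc
  have hb := Primrec.snd.comp hc
  have h1 : Primrec fun x : α × ℕ × ℕ => x.2.1 := Primrec.fst.comp Primrec.snd
  have h2 : Primrec fun x : α × ℕ × ℕ => x.2.2 := Primrec.snd.comp Primrec.snd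
  have hM' : Primrec fun x : α × ℕ × ℕ => N x.1 + 1 := hM.comp Primrec.fst
  exact (primrecPred_coherent hM hE).imp
    (((primrecPred_ext (r := fun x => Keep (N x + 1)) (primrecPred_keep hM' h1 h2) hb hE).imp
      (primrecPred_exists_sub Primrec.eq hC hm hE)).and
    ((primrecPred_ext (r := fun x => Renew (N x + 1)) (primrecPred_renew hM' h1 h2) hb hE).imp
      (primrecPred_exists_sub Primrec.nat_lt hC hm hE)))

theorem primrecPred_certifies :
    PrimrecPred fun x : ℕ × List (ℕ × List ℕ) => Certifies x.1 x.2 := by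
  refine PrimrecPred.and
    (PrimrecPred.ball (primrec_words_pow Primrec.fst (Primrec.const 1)) ?_)
    (PrimrecPred.ball Primrec.snd (PrimrecPred.ball (primrec_words_pow
      (Primrec.fst.comp Primrec.fst) (Primrec.list_length.comp
        (Primrec.snd.comp Primrec.snd))) ?_))
  · refine (primrecPred_coherent (Primrec.succ.comp (Primrec.fst.comp Primrec.fst))
      Primrec.snd).imp (PrimrecPred.imp ?_ ?_)
    · exact PrimrecPred.bex Primrec.snd (primrecPred_holds Primrec.snd
        (Primrec.fst.comp (Primrec.fst.comp Primrec.fst)))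
    · exact PrimrecPred.bex (Primrec.snd.comp Primrec.fst)
        (primrecPred_sub (Primrec.snd.comp Primrec.snd) (Primrec.snd.comp Primrec.fst))
  · exact primrecPred_closed (Primrec.fst.comp (Primrec.fst.comp Primrec.fst))
      (Primrec.snd.comp (Primrec.fst.comp Primrec.fst)) (Primrec.snd.comp Primrec.fst) Primrec.snd

/-- The `Denumerable` instance was built from this very numbering, so it is the encoding itself. -/
theorem primrec_toNat : Primrec Formula.toNat := Primrec.encode

theorem rePred_exists_certifies : REPred fun φ : Formula => ∃ C, Certifies φ.toNat C :=
  Partrec.comp (f := fun N : ℕ => Part.assert (∃ C, Certifies N C) fun _ => Part.some ())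
    (PrimrecPred.rePred_exists (p := Certifies) primrecPred_certifies) primrec_toNat.to_comp

end Computability

/-! ### Finite lists of points and their labels -/

/-- Over a list without duplicates, truth of `◇₁` can be read off the list of labels. -/
theorem exists_ne_iff_map {V : Type*} {f : V → ℕ} {Q : ℕ → Prop} {l : List V} (hl : l.Nodup)
    {x : V} (hx : x ∈ l) : (∃ y ∈ l, y ≠ x ∧ Q (f y)) ↔
      ∃ b ∈ l.map f, Q b ∧ (b ≠ f x ∨ 2 ≤ (l.map f).count (f x)) := by
  classical
  -- With one occurrence of `x` removed, multiplicity at least two of `f x` means that another point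
  -- carries the same label.
  have hp := List.perm_cons_erase hx
  have hc : (l.map f).count (f x) = ((l.erase x).map f).count (f x) + 1 := by
    rw [(hp.map f).count_eq]; simp
  have hmem : ∀ y, y ∈ l.erase x ↔ y ≠ x ∧ y ∈ l := fun y => hl.mem_erase_iff
  rw [hc]
  constructor
  · rintro ⟨y, hy, hyx, hQ⟩
    refine ⟨f y, List.mem_map_of_mem hy, hQ, or_iff_not_imp_left.2 fun h => ?_⟩
    have : f x ∈ (l.erase x).map f :=
      List.mem_map.2 ⟨y, (hmem y).2 ⟨hyx, hy⟩, not_not.1 h⟩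
    have := List.count_pos_iff.2 this
    omega
  · rintro ⟨b, hb, hQ, h⟩
    obtain ⟨y, hy, rfl⟩ := List.mem_map.1 hb
    by_cases hyx : f y = f x
    · have h1 : 0 < ((l.erase x).map f).count (f x) := by
        rcases h with h | h
        · exact absurd hyx h
        · omega
      obtain ⟨z, hz, hzx⟩ := List.mem_map.1 (List.count_pos_iff.1 h1)
      obtain ⟨h2, h3⟩ := (hmem z).1 hz
      exact ⟨z, h3, h2, by rwa [hzx, ← hyx]⟩
    · exact ⟨y, hy, fun h => hyx (by rw [h]), hQ⟩

/-- Two bits for each of `5 * M` codes: even positions store `s`, odd positions store `t`. -/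
theorem exists_label (M : ℕ) (s t : ℕ → Prop) : ∃ a < 2 ^ (10 * M),
    ∀ k < 5 * M, (Holds a k ↔ s k) ∧ (Pending a k ↔ t k) := by
  classical
  refine ⟨Nat.ofBits fun i : Fin (10 * M) =>
    if (i : ℕ) % 2 = 0 then decide (s (i / 2)) else decide (t (i / 2)), Nat.ofBits_lt_two_pow _,
    fun k hk => ⟨?_, ?_⟩⟩
  · rw [Holds, Nat.testBit_ofBits_lt _ _ (by omega)]
    simp
  · rw [Pending, Nat.testBit_ofBits_lt _ _ (by omega)]
    have h1 : (2 * k + 1) % 2 = 1 := by omega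
    have h2 : (2 * k + 1) / 2 = k := by omega
    simp [h1, h2]

/-- Finitely many elements witness, for each of finitely many properties, whether it holds at an
element different from a given one. -/
theorem exists_witnesses {V : Type*} (D : Set V) (Q : ℕ → V → Prop) (M : ℕ) (l : List V)
    (hl : l.Nodup) (hD : ∀ v ∈ l, v ∈ D) : ∃ w : List V, (l ++ w).Nodup ∧ (∀ v ∈ l ++ w, v ∈ D) ∧
      w.length ≤ 2 * M ∧
      ∀ k < M, ∀ v, (∃ y ∈ D, y ≠ v ∧ Q k y) → ∃ y ∈ l ++ w, y ≠ v ∧ Q k y := by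
  classical
  induction M with
  | zero => exact ⟨[], by simpa using hl, by simpa using hD, by simp, by simp⟩
  | succ M ih =>
    obtain ⟨w, hw, hwD, hlen, hQ⟩ := ih
    -- At most one new point provides a witness for `P`, if there is one in `D`.
    have extend : ∀ (w : List V) (P : V → Prop), (l ++ w).Nodup → (∀ v ∈ l ++ w, v ∈ D) →
        ∃ w' : List V, (l ++ w').Nodup ∧ (∀ v ∈ l ++ w', v ∈ D) ∧ w'.length ≤ w.length + 1 ∧
          (∀ v ∈ l ++ w, v ∈ l ++ w') ∧ ((∃ y ∈ D, P y) → ∃ y ∈ l ++ w', P y) := by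
      intro w P hn hD
      by_cases h : ∃ y ∈ D, P y ∧ y ∉ l ++ w
      · obtain ⟨y, hy, hP, hyw⟩ := h
        refine ⟨w ++ [y], ?_, ?_, by simp, fun v hv => ?_, fun _ => ⟨y, by simp, hP⟩⟩
        · rw [← List.append_assoc]
          exact hn.append (List.nodup_singleton y) (by simpa using hyw)
        · intro v hv
          rw [← List.append_assoc, List.mem_append, List.mem_singleton] at hv
          rcases hv with hv | rfl
          exacts [hD v hv, hy]
        · rw [← List.append_assoc]; exact List.mem_append_left _ hv
      · refine ⟨w, hn, hD, by omega, fun v hv => hv, ?_⟩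
        rintro ⟨y, hy, hP⟩
        exact ⟨y, by by_contra hyw; exact h ⟨y, hy, hP, hyw⟩, hP⟩
    obtain ⟨w₁, hn₁, hD₁, hl₁, hs₁, hP₁⟩ := extend w (Q M) hw hwD
    -- A witness `z` serves every `v ≠ z`; a second one, different from `z`, serves `v = z`. Hence
    -- two points per property.
    by_cases h : ∃ z ∈ l ++ w₁, Q M z
    · obtain ⟨z, hz, hQz⟩ := h
      obtain ⟨w₂, hn₂, hD₂, hl₂, hs₂, hP₂⟩ := extend w₁ (fun y => y ≠ z ∧ Q M y) hn₁ hD₁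
      refine ⟨w₂, hn₂, hD₂, by omega, fun k hk v hv => ?_⟩
      rcases Nat.lt_succ_iff_lt_or_eq.1 hk with hk | rfl
      · obtain ⟨y, hy, h⟩ := hQ k hk v hv
        exact ⟨y, hs₂ y (hs₁ y hy), h⟩
      · by_cases hvz : z = v
        · subst hvz
          exact hP₂ hv
        · exact ⟨z, hs₂ z hz, hvz, hQz⟩
    · refine ⟨w₁, hn₁, hD₁, by omega, fun k hk v hv => ?_⟩
      rcases Nat.lt_succ_iff_lt_or_eq.1 hk with hk | rfl
      · obtain ⟨y, hy, h⟩ := hQ k hk v hv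
        exact ⟨y, hs₁ y hy, h⟩
      · obtain ⟨y, hy, -, hQy⟩ := hv
        exact absurd (hP₁ ⟨y, hy, hQy⟩) h

/-- Lifts a multiset of labels from a certificate to actual points of the model, listed in the order
that the certificate uses. -/
theorem exists_map_eq_of_subperm {V : Type*} {f : V → ℕ} {l : List V} {b : List ℕ}
    (hl : l.Nodup) (h : b.Subperm (l.map f)) :
    ∃ l' : List V, l'.Nodup ∧ (∀ v ∈ l', v ∈ l) ∧ b = l'.map f := by
  obtain ⟨c, hc, hs⟩ := h
  obtain ⟨l₁, hl₁, rfl⟩ := List.sublist_map_iff.1 hs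
  have h₁ : List.Forall₂ (fun a v => a = f v) (l₁.map f) l₁ := by
    rw [List.forall₂_map_left_iff, List.forall₂_same]
    exact fun _ _ => rfl
  obtain ⟨l₂, h₂, hp⟩ := List.perm_comp_forall₂ hc.symm h₁
  refine ⟨l₂, hp.nodup_iff.2 (hl.sublist hl₁), fun v hv => hl₁.subset (hp.mem_iff.1 hv), ?_⟩
  rw [← List.forall₂_eq_eq_eq, List.forall₂_map_right_iff]
  exact h₂

/-! ### Soundness: a model refutes every certificate -/

/-- Models over expanding domains, with truth given on codes of formulas. -/
structure ExpandingModel (V : Type*) where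
  dom : ℕ → Set V
  mono : ∀ {m n}, m ≤ n → dom m ⊆ dom n
  truth : ℕ → V → ℕ → Prop
  truth_neg : ∀ {n v}, v ∈ dom n → ∀ k, truth n v (5 * k + 1) ↔ ¬ truth n v k
  truth_and : ∀ {n v}, v ∈ dom n → ∀ k,
    truth n v (5 * k + 2) ↔ truth n v k.unpair.1 ∧ truth n v k.unpair.2
  truth_dia0 : ∀ {n v}, v ∈ dom n → ∀ k, truth n v (5 * k + 3) ↔ ∃ m, n < m ∧ truth m v k
  truth_dia1 : ∀ {n v}, v ∈ dom n → ∀ k,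
    truth n v (5 * k + 4) ↔ ∃ w ∈ dom n, w ≠ v ∧ truth n w k

namespace ExpandingModel

variable {V : Type*} (𝔐 : ExpandingModel V)

/-- The label of `v` at time `n`, where those formulas are pending that become true later, but not
after time `c`. -/
noncomputable def label (M n c : ℕ) (v : V) : ℕ :=
  (exists_label M (𝔐.truth n v) fun k => ∃ m, n < m ∧ m ≤ c ∧ 𝔐.truth m v k).choose

variable {M n c k : ℕ} {v : V}

theorem label_lt : 𝔐.label M n c v < 2 ^ (10 * M) :=
  (exists_label M (𝔐.truth n v) fun k => ∃ m, n < m ∧ m ≤ c ∧ 𝔐.truth m v k).choose_spec.1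

theorem holds_label (hk : k < 5 * M) : Holds (𝔐.label M n c v) k ↔ 𝔐.truth n v k :=
  ((exists_label M (𝔐.truth n v) fun k =>
    ∃ m, n < m ∧ m ≤ c ∧ 𝔐.truth m v k).choose_spec.2 k hk).1

theorem pending_label (hk : k < 5 * M) :
    Pending (𝔐.label M n c v) k ↔ ∃ m, n < m ∧ m ≤ c ∧ 𝔐.truth m v k :=
  ((exists_label M (𝔐.truth n v) fun k =>
    ∃ m, n < m ∧ m ≤ c ∧ 𝔐.truth m v k).choose_spec.2 k hk).2

theorem next_label (hv : v ∈ 𝔐.dom n) (c c' : ℕ) :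
    Next M (𝔐.label M n c v) (𝔐.label M (n + 1) c' v) := by
  intro k hk
  rw [𝔐.holds_label (by omega), 𝔐.holds_label (by omega), 𝔐.holds_label (by omega),
    𝔐.truth_dia0 hv, 𝔐.truth_dia0 (𝔐.mono (Nat.le_succ n) hv)]
  constructor
  · rintro ⟨m, hm, h⟩
    rcases Nat.eq_or_lt_of_le (Nat.succ_le_of_lt hm) with rfl | hm
    exacts [Or.inl h, Or.inr ⟨m, hm, h⟩]
  · rintro (h | ⟨m, hm, h⟩)
    exacts [⟨n + 1, by omega, h⟩, ⟨m, by omega, h⟩]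

theorem keep_label (hv : v ∈ 𝔐.dom n) :
    Keep M (𝔐.label M n c v) (𝔐.label M (n + 1) c v) := by
  refine ⟨𝔐.next_label hv c c, fun k hk => ?_⟩
  rw [𝔐.pending_label (by omega), 𝔐.pending_label (by omega), 𝔐.holds_label (by omega)]
  rintro ⟨m, hm, hc, h⟩
  rcases Nat.eq_or_lt_of_le (Nat.succ_le_of_lt hm) with rfl | hm
  exacts [Or.inl h, Or.inr ⟨m, hm, hc, h⟩]

/-- At time `n` with deadline `n` nothing is pending, as no `m` satisfies `n < m ≤ n`; the new
deadline `c` is late enough for all promises made at `n`. -/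
theorem renew_label (hv : v ∈ 𝔐.dom n)
    (hc : ∀ k < M, 𝔐.truth n v (5 * k + 3) → ∃ m, n < m ∧ m ≤ c ∧ 𝔐.truth m v k) :
    Renew M (𝔐.label M n n v) (𝔐.label M (n + 1) c v) := by
  refine ⟨𝔐.next_label hv n c, fun k hk => ?_⟩
  rw [𝔐.pending_label (by omega), 𝔐.pending_label (by omega), 𝔐.holds_label (by omega),
    𝔐.holds_label (by omega)]
  refine ⟨fun ⟨m, h1, h2, _⟩ => by omega, fun h => ?_⟩
  obtain ⟨m, hm, hc, h⟩ := hc k hk h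
  rcases Nat.eq_or_lt_of_le (Nat.succ_le_of_lt hm) with rfl | hm
  exacts [Or.inl h, Or.inr ⟨m, hm, hc, h⟩]

/-- Only finitely many pairs of a point and a code are involved, so the maximum of the fulfilment
times works. -/
theorem exists_deadline (M n : ℕ) (l : List V) (hl : ∀ v ∈ l, v ∈ 𝔐.dom n) : ∃ c, n < c ∧
    ∀ v ∈ l, ∀ k < M, 𝔐.truth n v (5 * k + 3) → ∃ m, n < m ∧ m ≤ c ∧ 𝔐.truth m v k := by
  classical
  have h (v : V) (k : ℕ) : ∃ c, v ∈ l → 𝔐.truth n v (5 * k + 3) →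
      ∃ m, n < m ∧ m ≤ c ∧ 𝔐.truth m v k := by
    by_cases h : v ∈ l ∧ 𝔐.truth n v (5 * k + 3)
    · obtain ⟨m, hm, ht⟩ := (𝔐.truth_dia0 (hl v h.1) k).1 h.2
      exact ⟨m, fun _ _ => ⟨m, hm, le_rfl, ht⟩⟩
    · exact ⟨0, fun h1 h2 => absurd ⟨h1, h2⟩ h⟩
  choose c hc using h
  let S := (l.toFinset ×ˢ Finset.range M).sup fun x => c x.1 x.2
  refine ⟨n + 1 + S, by omega, fun v hv k hk ht => ?_⟩
  obtain ⟨m, hm, hmc, h⟩ := hc v k hv ht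
  have hS : c v k ≤ S := Finset.le_sup (f := fun x : V × ℕ => c x.1 x.2) (b := (v, k))
    (by simp [hv, hk])
  exact ⟨m, hm, by omega, h⟩

/-- Every finite set of points extends to one whose labels are coherent. -/
theorem exists_coherent (M n c : ℕ) (l : List V) (hn : l.Nodup) (hl : ∀ v ∈ l, v ∈ 𝔐.dom n) :
    ∃ w : List V, (l ++ w).Nodup ∧ (∀ v ∈ l ++ w, v ∈ 𝔐.dom n) ∧
      (l ++ w).map (𝔐.label M n c) ∈ words (2 ^ (10 * M)) (l.length + 2 * M) ∧
      Coherent M ((l ++ w).map (𝔐.label M n c)) := by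
  obtain ⟨w, hw, hD, hlen, hQ⟩ :=
    exists_witnesses (𝔐.dom n) (fun k v => 𝔐.truth n v k) M l hn hl
  refine ⟨w, hw, hD, mem_words.2 ⟨by simp; omega, ?_⟩, ?_⟩
  · intro a ha
    obtain ⟨v, -, rfl⟩ := List.mem_map.1 ha
    exact 𝔐.label_lt
  · intro a ha
    obtain ⟨v, hv, rfl⟩ := List.mem_map.1 ha
    refine ⟨𝔐.label_lt, fun k hk => ⟨?_, ?_, ?_⟩⟩
    · rw [𝔐.holds_label (by omega), 𝔐.holds_label (by omega), 𝔐.truth_neg (hD v hv)]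
    · have h1 := Nat.unpair_left_le k
      have h2 := Nat.unpair_right_le k
      rw [𝔐.holds_label (by omega), 𝔐.holds_label (by omega), 𝔐.holds_label (by omega),
        𝔐.truth_and (hD v hv)]
    · rw [𝔐.holds_label (by omega), 𝔐.truth_dia1 (hD v hv),
        ← exists_ne_iff_map (Q := fun b => Holds b k) hw hv]
      simp only [𝔐.holds_label (show k < 5 * M by omega)]
      exact ⟨hQ k hk v, fun ⟨y, hy, h⟩ => ⟨y, hD y hy, h⟩⟩

theorem ext_map {r : ℕ → ℕ → Prop} {f g : V → ℕ} {l w : List V} (h : ∀ v ∈ l, r (f v) (g v)) :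
    Ext r (l.map f) ((l ++ w).map g) := by
  refine ⟨by simp, fun i hi => ?_⟩
  rw [List.length_map] at hi
  have h1 : i < (l ++ w).length := by rw [List.length_append]; omega
  rw [List.getD_eq_getElem _ _ (by simpa using hi), List.getD_eq_getElem _ _ (by simpa using h1),
    List.getElem_map, List.getElem_map, List.getElem_append_left hi]
  exact h _ (List.getElem_mem hi)

/-- Points of a model can be followed along a certificate until the levels are exhausted. -/
theorem not_certified {N : ℕ} {C : List (ℕ × List ℕ)} (hC : Certifies N C) (m : ℕ) :
    ∀ (d n : ℕ) (l : List V), l.Nodup → (∀ v ∈ l, v ∈ 𝔐.dom n) →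
      (m, l.map (𝔐.label (N + 1) n (n + d))) ∉ C := by
  induction m using Nat.strong_induction_on with
  | _ m ihm =>
    -- Inner induction on the time `d` left before the deadline `n + d`: keeping moves use up `d` at
    -- the same level, and the renewing move at `d = 0` lowers the level `m` and may choose any new
    -- `d`.
    intro d
    induction d with
    | zero =>
      intro n l hn hl hmem
      obtain ⟨c, hc, hdl⟩ := 𝔐.exists_deadline (N + 1) n l hl
      obtain ⟨w, hwn, hwD, hw, hcoh⟩ := 𝔐.exists_coherent (N + 1) (n + 1) c l hn
        fun v hv => 𝔐.mono (Nat.le_succ n) (hl v hv)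
      obtain ⟨⟨m', b⟩, hb, hlt, hsub⟩ := (hC.2 _ hmem _ (by simpa using hw) hcoh).2
        (ext_map fun v hv => 𝔐.renew_label (hl v hv) (hdl v hv))
      obtain ⟨l', hn', hl', rfl⟩ := exists_map_eq_of_subperm hwn (sub_iff.1 hsub)
      obtain ⟨d, rfl⟩ := Nat.exists_eq_add_of_le (Nat.succ_le_of_lt hc)
      exact ihm m' hlt d (n + 1) l' hn' (fun v hv => hwD v (hl' v hv)) hb
    | succ d ihd =>
      intro n l hn hl hmem
      obtain ⟨w, hwn, hwD, hw, hcoh⟩ := 𝔐.exists_coherent (N + 1) (n + 1) (n + (d + 1)) l hn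
        fun v hv => 𝔐.mono (Nat.le_succ n) (hl v hv)
      obtain ⟨⟨m', b⟩, hb, heq, hsub⟩ := (hC.2 _ hmem _ (by simpa using hw) hcoh).1
        (ext_map fun v hv => 𝔐.keep_label (hl v hv))
      obtain ⟨l', hn', hl', rfl⟩ := exists_map_eq_of_subperm hwn (sub_iff.1 hsub)
      simp only at heq
      subst heq
      rw [show n + (d + 1) = n + 1 + d by omega] at hb
      exact ihd (n + 1) l' hn' (fun v hv => hwD v (hl' v hv)) hb

theorem not_certifies {N : ℕ} (hv : v ∈ 𝔐.dom n) (h : 𝔐.truth n v N)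
    (C : List (ℕ × List ℕ)) : ¬ Certifies N C := by
  intro hC
  obtain ⟨w, hwn, hwD, hw, hcoh⟩ := 𝔐.exists_coherent (N + 1) n n [v] (List.nodup_singleton v)
    (by simpa using hv)
  obtain ⟨⟨m, b⟩, hb, hsub⟩ := hC.1 _ hw hcoh
    ⟨𝔐.label (N + 1) n n v, by simp, (𝔐.holds_label (by omega)).2 h⟩
  obtain ⟨l', hn', hl', rfl⟩ := exists_map_eq_of_subperm hwn (sub_iff.1 hsub)
  exact 𝔐.not_certified hC m 0 n l' hn' (fun v hv => hwD v (hl' v hv)) hb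

end ExpandingModel

end Bimodal.Sat

/-! ### Completeness: well-quasi-orders, stabilisation and finite bases -/

/-- Without a finite basis one could keep choosing elements above none of the earlier ones, giving a
bad sequence. -/
theorem Set.PartiallyWellOrderedOn.exists_finite_basis {α : Type*} {r : α → α → Prop} {s : Set α}
    (hs : s.PartiallyWellOrderedOn r) (p : α → Prop) :
    ∃ B : Finset α, (∀ b ∈ B, b ∈ s ∧ p b) ∧ ∀ x ∈ s, p x → ∃ b ∈ B, r b x := by
  by_contra! h
  obtain ⟨f, hf, hr⟩ := exists_seq_of_forall_finset_exists (fun x => x ∈ s ∧ p x)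
    (fun b x => ¬ r b x) fun B hB => by
      obtain ⟨x, hx, hp, hr⟩ := h B hB
      exact ⟨x, ⟨hx, hp⟩, hr⟩
  obtain ⟨m, n, hmn, h⟩ := hs fun n => ⟨f n, (hf n).1⟩
  exact hr m n hmn h

namespace Bimodal.Sat

/-- Higman's lemma over a finite alphabet; the sublist order implies multiset inclusion. -/
theorem partiallyWellOrderedOn_subperm (A : ℕ) :
    {l : List ℕ | ∀ a ∈ l, a < A}.PartiallyWellOrderedOn List.Subperm := by
  have h := Set.PartiallyWellOrderedOn.partiallyWellOrderedOn_sublistForall₂ (· = ·)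
    ((Set.finite_Iio A).partiallyWellOrderedOn (r := (· = ·)))
  intro f
  obtain ⟨m, n, hmn, hr⟩ := h f
  obtain ⟨l, hl, hs⟩ := List.sublistForall₂_iff.1 hr
  rw [List.forall₂_eq_eq_eq] at hl
  exact ⟨m, n, hmn, show (f m).1.Subperm (f n).1 from hl ▸ hs.subperm⟩

theorem Coherent.of_perm {M : ℕ} {E F : List ℕ} (h : Coherent M E) (hp : E.Perm F) :
    Coherent M F := by
  intro a ha
  have := h a (hp.mem_iff.2 ha)
  simpa only [hp.mem_iff, hp.count_eq] using this

theorem ext_iff {r : ℕ → ℕ → Prop} {E F : List ℕ} :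
    Ext r E F ↔ ∃ c d, F = c ++ d ∧ List.Forall₂ r E c := by
  constructor
  · rintro ⟨hl, h⟩
    refine ⟨F.take E.length, F.drop E.length, (List.take_append_drop _ _).symm, ?_⟩
    rw [List.forall₂_iff_get]
    refine ⟨by simp [hl], fun i h1 h2 => ?_⟩
    have := h i h1
    rw [List.getD_eq_getElem _ _ h1, List.getD_eq_getElem _ _ (by omega)] at this
    simpa using this
  · rintro ⟨c, d, rfl, h⟩
    refine ⟨by rw [List.length_append, h.length_eq]; omega, fun i hi => ?_⟩
    have hi' : i < c.length := h.length_eq ▸ hi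
    rw [List.getD_eq_getElem _ _ hi, List.getD_eq_getElem _ _ (by simp; omega),
      List.getElem_append_left hi']
    exact h.get hi hi'

/-- This is where expanding domains matter: successors of the points dropped from `E` are moved
behind those of `E'` and become new points. -/
theorem Ext.of_subperm {r : ℕ → ℕ → Prop} {E E' F : List ℕ} (h : Ext r E F)
    (hs : E'.Subperm E) : ∃ F', F.Perm F' ∧ Ext r E' F' := by
  obtain ⟨c, d, rfl, hf⟩ := ext_iff.1 h
  obtain ⟨t, ht⟩ : ∃ t, E.Perm (E' ++ t) := by
    obtain ⟨l, hl, hs⟩ := hs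
    obtain ⟨t, ht⟩ := hs.exists_perm_append
    exact ⟨t, ht.trans (hl.append_right t)⟩
  obtain ⟨c', hc', hp⟩ := List.perm_comp_forall₂ ht.symm hf
  obtain ⟨c₁, c₂, h1, h2, rfl⟩ : ∃ c₁ c₂, List.Forall₂ r E' c₁ ∧ List.Forall₂ r t c₂ ∧
      c' = c₁ ++ c₂ :=
    ⟨_, _, by simpa using List.forall₂_take E'.length hc',
      by simpa using List.forall₂_drop E'.length hc',
      (List.take_append_drop _ _).symm⟩
  refine ⟨c₁ ++ (c₂ ++ d), ?_, ext_iff.2 ⟨c₁, _, rfl, h1⟩⟩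
  rw [← List.append_assoc]
  exact hp.symm.append_right d

/-- A coherent extension step. -/
def Move (r : ℕ → ℕ → ℕ → Prop) (M : ℕ) (E F : List ℕ) : Prop := Ext (r M) E F ∧ Coherent M F

theorem Move.of_subperm {r : ℕ → ℕ → ℕ → Prop} {M : ℕ} {E E' F : List ℕ} (h : Move r M E F)
    (hs : E'.Subperm E) : ∃ F', F.Perm F' ∧ Move r M E' F' := by
  obtain ⟨F', hp, hF⟩ := h.1.of_subperm hs
  exact ⟨F', hp, hF, h.2.of_perm hp⟩

/-- `m` checkpoints can be passed from `E`. -/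
def Passes (M : ℕ) : ℕ → List ℕ → Prop
  | 0, _ => True
  | m + 1, E => ∃ F G, Relation.ReflTransGen (Move Keep M) E F ∧ Move Renew M F G ∧ Passes M m G

variable {M : ℕ}

theorem Passes.of_succ {m : ℕ} {E : List ℕ} (h : Passes M (m + 1) E) : Passes M m E := by
  induction m generalizing E with
  | zero => trivial
  | succ m ih =>
    obtain ⟨F, G, h1, h2, h3⟩ := h
    exact ⟨F, G, h1, h2, ih h3⟩

theorem Passes.of_le {m n : ℕ} (hmn : m ≤ n) {E : List ℕ} (h : Passes M n E) : Passes M m E := by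
  induction n, hmn using Nat.le_induction with
  | base => exact h
  | succ n _ ih => exact ih h.of_succ

theorem Passes.of_keep {m : ℕ} {E F : List ℕ} (h : Move Keep M E F) (hF : Passes M m F) :
    Passes M m E := by
  cases m with
  | zero => trivial
  | succ m =>
    obtain ⟨G, H, h1, h2, h3⟩ := hF
    exact ⟨G, H, h1.head h, h2, h3⟩

theorem Passes.of_renew {m : ℕ} {E F : List ℕ} (h : Move Renew M E F) (hF : Passes M m F) :
    Passes M (m + 1) E :=
  ⟨E, F, .refl, h, hF⟩

theorem Passes.of_subperm {m : ℕ} {E E' : List ℕ} (h : Passes M m E) (hs : E'.Subperm E) :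
    Passes M m E' := by
  induction m generalizing E E' with
  | zero => trivial
  | succ m ih =>
    obtain ⟨F, G, h1, h2, h3⟩ := h
    induction h1 using Relation.ReflTransGen.head_induction_on generalizing E' with
    | refl =>
      obtain ⟨G', hp, hG⟩ := h2.of_subperm hs
      exact .of_renew hG (ih h3 hp.symm.subperm)
    | head h _ ihh =>
      obtain ⟨H, hp, hH⟩ := h.of_subperm hs
      exact .of_keep hH (ihh hp.symm.subperm)

/-- Otherwise pick, for every `n`, a multiset passing exactly `n` checkpoints. For some `m < n` the
`m`-th is included in the `n`-th, and so passes `m + 1`. -/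
theorem exists_passes_succ (M : ℕ) : ∃ n, ∀ E : List ℕ, (∀ a ∈ E, a < 2 ^ (10 * M)) →
    Passes M n E → Passes M (n + 1) E := by
  by_contra! h
  choose f hf hp hn using h
  obtain ⟨m, n, hmn, hs⟩ := partiallyWellOrderedOn_subperm _ fun n => ⟨f n, hf n⟩
  exact hn m (((hp n).of_le hmn).of_subperm hs)

/-- A renewing move is reached after `d` keeping moves, and satisfies `p`. -/
def Reaches (M : ℕ) (p : List ℕ → Prop) : ℕ → List ℕ → Prop
  | 0, E => ∃ F, Move Renew M E F ∧ p F
  | d + 1, E => ∃ F, Move Keep M E F ∧ Reaches M p d F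

theorem Passes.exists_reaches {m : ℕ} {E : List ℕ} (h : Passes M (m + 1) E) :
    ∃ d, Reaches M (Passes M m) d E := by
  obtain ⟨F, G, h1, h2, h3⟩ := h
  induction h1 using Relation.ReflTransGen.head_induction_on with
  | refl => exact ⟨0, G, h2, h3⟩
  | head h _ ih =>
    obtain ⟨d, hd⟩ := ih
    exact ⟨d + 1, _, h, hd⟩

/-- An infinite sequence of moves with infinitely many renewing ones. -/
structure Run (M : ℕ) where
  state : ℕ → List ℕ
  rank : ℕ → ℕ
  coherent : ∀ n, Coherent M (state n)
  move : ∀ n, Ext (Renew M) (state n) (state (n + 1)) ∨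
    Ext (Keep M) (state n) (state (n + 1)) ∧ rank (n + 1) < rank n

theorem exists_run {n : ℕ} (hn : ∀ E : List ℕ, (∀ a ∈ E, a < 2 ^ (10 * M)) →
    Passes M n E → Passes M (n + 1) E) {E : List ℕ} (hE : Coherent M E) (hp : Passes M n E) :
    ∃ 𝔯 : Run M, 𝔯.state 0 = E := by
  -- Each state carries a countdown to its next renewal. After that renewal level `n` is still
  -- passed, so stability supplies a new countdown.
  let X := {x : ℕ × List ℕ // Coherent M x.2 ∧ Reaches M (Passes M n) x.1 x.2}
  have start : ∀ E, Coherent M E → Passes M n E → ∃ x : X, x.1.2 = E := fun E hE hp => by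
    obtain ⟨d, hd⟩ := (hn E (fun a ha => (hE a ha).1) hp).exists_reaches
    exact ⟨⟨(d, E), hE, hd⟩, rfl⟩
  have step : ∀ x : X, ∃ y : X, Ext (Renew M) x.1.2 y.1.2 ∨
      Ext (Keep M) x.1.2 y.1.2 ∧ y.1.1 < x.1.1 := by
    rintro ⟨⟨d, E⟩, hE, hd⟩
    cases d with
    | zero =>
      obtain ⟨F, hF, hp⟩ := hd
      obtain ⟨y, rfl⟩ := start F hF.2 hp
      exact ⟨y, Or.inl hF.1⟩
    | succ d =>
      obtain ⟨F, hF, hp⟩ := hd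
      exact ⟨⟨(d, F), hF.2, hp⟩, Or.inr ⟨hF.1, Nat.lt_succ_self d⟩⟩
  choose next hnext using step
  obtain ⟨x, hx⟩ := start E hE hp
  let s : ℕ → X := fun k => Nat.rec x (fun _ y => next y) k
  exact ⟨⟨fun k => (s k).1.2, fun k => (s k).1.1, fun k => (s k).2.1, fun k => hnext (s k)⟩, hx⟩

/-- If no initial state starts an infinite run, then there is a certificate. -/
theorem exists_certifies {N : ℕ}
    (h : ¬ ∃ 𝔯 : Run (N + 1), ∃ a ∈ 𝔯.state 0, Holds a N) : ∃ C, Certifies N C := by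
  obtain ⟨n, hn⟩ := exists_passes_succ (N + 1)
  choose B hB hbasis using fun m => (partiallyWellOrderedOn_subperm
    (2 ^ (10 * (N + 1)))).exists_finite_basis fun E => ¬ Passes (N + 1) m E
  let C : List (ℕ × List ℕ) := (List.range (n + 1)).flatMap fun m => (B m).toList.map (Prod.mk m)
  have hC : ∀ m E, (m, E) ∈ C ↔ m ≤ n ∧ E ∈ B m := by
    intro m E
    simp only [C, List.mem_flatMap, List.mem_range, List.mem_map, Finset.mem_toList,
      Prod.mk.injEq]
    constructor
    · rintro ⟨_, h1, _, h2, rfl, rfl⟩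
      exact ⟨by omega, h2⟩
    · rintro ⟨h1, h2⟩
      exact ⟨m, by omega, E, h2, rfl, rfl⟩
  have hmem : ∀ m ≤ n, ∀ E, Coherent (N + 1) E → ¬ Passes (N + 1) m E →
      ∃ b, (m, b) ∈ C ∧ Sub b E := by
    intro m hm E hE hp
    obtain ⟨b, hb, hs⟩ := hbasis m E (fun a ha => (hE a ha).1) hp
    exact ⟨b, (hC m b).2 ⟨hm, hb⟩, sub_iff.2 hs⟩
  refine ⟨C, fun E _ hE hN => ?_, ?_⟩
  · obtain ⟨b, hb, hs⟩ := hmem n le_rfl E hE fun hp => by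
      obtain ⟨𝔯, rfl⟩ := exists_run hn hE hp
      exact h ⟨𝔯, hN⟩
    exact ⟨_, hb, hs⟩
  · rintro ⟨m, b⟩ hb E - hE
    obtain ⟨hm, hbB⟩ := (hC m b).1 hb
    have hbad := (hB m b hbB).2
    constructor
    · intro hx
      obtain ⟨b', hb', hs⟩ := hmem m hm E hE fun hp => hbad (.of_keep ⟨hx, hE⟩ hp)
      exact ⟨_, hb', rfl, hs⟩
    · intro hx
      cases m with
      -- Level `0` contains every multiset, so its basis is empty and no renewal from it need be
      -- considered.
      | zero => exact absurd trivial hbad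
      | succ m =>
        obtain ⟨b', hb', hs⟩ := hmem m (by omega) E hE fun hp => hbad (.of_renew ⟨hx, hE⟩ hp)
        exact ⟨_, hb', Nat.lt_succ_self m, hs⟩

/-! ### Truth along a run -/

namespace Run

variable (𝔯 : Run M)

/-- The label of the `i`-th point at time `n`. -/
def lab (n i : ℕ) : ℕ := (𝔯.state n).getD i 0

theorem length_mono {m n : ℕ} (h : m ≤ n) : (𝔯.state m).length ≤ (𝔯.state n).length := by
  refine monotone_nat_of_le_succ (f := fun n => (𝔯.state n).length) (fun n => ?_) h
  rcases 𝔯.move n with h | h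
  exacts [h.1, h.1.1]

theorem exists_renew (n : ℕ) : ∃ m ≥ n, Ext (Renew M) (𝔯.state m) (𝔯.state (m + 1)) := by
  induction h : 𝔯.rank n using Nat.strong_induction_on generalizing n with
  | _ d ih =>
    subst h
    rcases 𝔯.move n with h | ⟨-, h⟩
    · exact ⟨n, le_rfl, h⟩
    · obtain ⟨m, hm, hr⟩ := ih _ h (n + 1) rfl
      exact ⟨m, by omega, hr⟩

variable {n i k : ℕ}

theorem holds_dia0_iff_succ (hi : i < (𝔯.state n).length) (hk : k < M) :
    Holds (𝔯.lab n i) (5 * k + 3) ↔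
      Holds (𝔯.lab (n + 1) i) k ∨ Holds (𝔯.lab (n + 1) i) (5 * k + 3) := by
  rcases 𝔯.move n with h | ⟨h, -⟩
  exacts [(h.2 i hi).1 k hk, (h.2 i hi).1 k hk]

/-- An unfulfilled `◇₀` would be passed on forever; the next renewal makes its argument pending, and
it stays so, contradicting the renewal after that, which requires nothing pending. -/
theorem holds_dia0_iff (hi : i < (𝔯.state n).length) (hk : k < M) :
    Holds (𝔯.lab n i) (5 * k + 3) ↔ ∃ m, n < m ∧ Holds (𝔯.lab m i) k := by
  have hlen : ∀ m ≥ n, i < (𝔯.state m).length := fun m hm => hi.trans_le (𝔯.length_mono hm)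
  constructor
  · intro h
    by_contra! hno
    have hdia : ∀ m ≥ n, Holds (𝔯.lab m i) (5 * k + 3) := by
      intro m hm
      induction m, hm using Nat.le_induction with
      | base => exact h
      | succ m hm ih =>
        exact ((𝔯.holds_dia0_iff_succ (hlen m hm) hk).1 ih).resolve_left (hno _ (by omega))
    obtain ⟨m₁, hm₁, h₁⟩ := 𝔯.exists_renew n
    have hpend : ∀ m ≥ m₁ + 1, Pending (𝔯.lab m i) k := by
      intro m hm
      induction m, hm using Nat.le_induction with
      | base =>
        exact (((h₁.2 i (hlen _ hm₁)).2 k hk).2 (hdia m₁ hm₁)).resolve_left (hno _ (by omega))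
      | succ m hm ih =>
        have hl := hlen m (by omega)
        rcases 𝔯.move m with h | ⟨h, -⟩
        · exact absurd ih ((h.2 i hl).2 k hk).1
        · exact ((h.2 i hl).2 k hk ih).resolve_left (hno _ (by omega))
    obtain ⟨m₂, hm₂, h₂⟩ := 𝔯.exists_renew (m₁ + 1)
    exact ((h₂.2 i (hlen _ (by omega))).2 k hk).1 (hpend m₂ hm₂)
  · rintro ⟨m, hm, h⟩
    obtain ⟨d, rfl⟩ := Nat.exists_eq_add_of_lt hm
    clear hm
    induction d generalizing n with
    | zero => exact (𝔯.holds_dia0_iff_succ hi hk).2 (Or.inl h)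
    | succ d ih =>
      refine (𝔯.holds_dia0_iff_succ hi hk).2 (Or.inr (ih (hlen _ (by omega))
        (fun m hm => hlen m (by omega)) ?_))
      rwa [show n + 1 + d + 1 = n + (d + 1) + 1 by omega]

theorem lab_mem (hi : i < (𝔯.state n).length) : 𝔯.lab n i ∈ 𝔯.state n := by
  rw [lab, List.getD_eq_getElem _ _ hi]
  exact List.getElem_mem hi

theorem holds_neg_iff (hi : i < (𝔯.state n).length) (hk : k < M) :
    Holds (𝔯.lab n i) (5 * k + 1) ↔ ¬ Holds (𝔯.lab n i) k :=
  ((𝔯.coherent n _ (𝔯.lab_mem hi)).2 k hk).1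

theorem holds_and_iff (hi : i < (𝔯.state n).length) (hk : k < M) :
    Holds (𝔯.lab n i) (5 * k + 2) ↔
      Holds (𝔯.lab n i) k.unpair.1 ∧ Holds (𝔯.lab n i) k.unpair.2 :=
  ((𝔯.coherent n _ (𝔯.lab_mem hi)).2 k hk).2.1

/-- Positions in the list serve as points, so equal labels at different positions are different
points; the multiplicity clause of `Coherent` says exactly this. -/
theorem holds_dia1_iff (hi : i < (𝔯.state n).length) (hk : k < M) :
    Holds (𝔯.lab n i) (5 * k + 4) ↔
      ∃ j, j < (𝔯.state n).length ∧ j ≠ i ∧ Holds (𝔯.lab n j) k := by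
  have hmap : 𝔯.state n = (List.range (𝔯.state n).length).map (𝔯.lab n) := by
    refine List.ext_getElem (by simp) fun j h1 h2 => ?_
    simp [lab, h1]
  rw [((𝔯.coherent n _ (𝔯.lab_mem hi)).2 k hk).2.2]
  conv_lhs => rw [hmap]
  rw [← exists_ne_iff_map (Q := fun b => Holds b k) List.nodup_range (List.mem_range.2 hi)]
  simp only [List.mem_range]

end Run

end Bimodal.Sat

/-! ### Transfer to expanding 2-frames -/

namespace Bimodal

namespace Sat

/-- The formula with a given code. -/
noncomputable def ofCode (k : ℕ) : Formula := (Formula.toNat_surjective k).choose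

theorem toNat_ofCode (k : ℕ) : (ofCode k).toNat = k := (Formula.toNat_surjective k).choose_spec

theorem ofCode_eq {k : ℕ} {φ : Formula} (h : φ.toNat = k) : ofCode k = φ :=
  Formula.toNat_injective ((toNat_ofCode k).trans h.symm)

theorem ofCode_neg (k : ℕ) : ofCode (5 * k + 1) = .neg (ofCode k) :=
  ofCode_eq (by simp only [Formula.toNat, toNat_ofCode])

theorem ofCode_and (k : ℕ) :
    ofCode (5 * k + 2) = .and (ofCode k.unpair.1) (ofCode k.unpair.2) :=
  ofCode_eq (by simp only [Formula.toNat, toNat_ofCode, Nat.pair_unpair])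

theorem ofCode_dia0 (k : ℕ) : ofCode (5 * k + 3) = .dia0 (ofCode k) :=
  ofCode_eq (by simp only [Formula.toNat, toNat_ofCode])

theorem ofCode_dia1 (k : ℕ) : ofCode (5 * k + 4) = .dia1 (ofCode k) :=
  ofCode_eq (by simp only [Formula.toNat, toNat_ofCode])

section

variable {V : Type u} (G : omegaFrame.carrier → Frame V)
  (hG : ∀ x y : omegaFrame.carrier, omegaFrame.rel x y → (G x).IsSubframe (G y))
  (hdiff : ∀ x, ⟨V, G x⟩ ∈ diffFrames.{u}) (ν : (frameSum omegaFrame G).Valuation)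

/-- The world `⟨n, v⟩` of an expanding 2-frame over `⟨ω, <⟩`. -/
def world (n : ℕ) (v : V) (h : v ∈ (G ⟨n, trivial⟩).carrier) : (frameSum omegaFrame G).World :=
  ⟨⟨n, trivial⟩, ⟨v, h⟩⟩

/-- Truth in a model based on an expanding 2-frame, as a relation between times, points and
codes of formulas. -/
noncomputable def ofFrame : ExpandingModel V where
  dom n := (G ⟨n, trivial⟩).carrier
  mono {m n} hmn := by
    rcases Nat.eq_or_lt_of_le hmn with rfl | h
    exacts [subset_rfl, (hG ⟨m, trivial⟩ ⟨n, trivial⟩ h).1]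
  -- Everything is false off the domain; this is harmless because the clauses of `ExpandingModel`
  -- are required only at points of the domain.
  truth n v k := ∃ h, (frameSum omegaFrame G).Truth ν (world G n v h) (ofCode k)
  truth_neg {n v} h k := by
    simp only [ofCode_neg, TwoFrame.Truth, h, exists_true_left]
  truth_and {n v} h k := by
    simp only [ofCode_and, TwoFrame.Truth, h, exists_true_left]
  truth_dia0 {n v} h k := by
    simp only [ofCode_dia0, TwoFrame.Truth, h, exists_true_left]
    constructor
    · rintro ⟨⟨⟨m, _⟩, ⟨w, hw⟩⟩, ⟨hr, he⟩, ht⟩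
      obtain rfl : v = w := he
      exact ⟨m, hr, hw, ht⟩
    · rintro ⟨m, hm, hw, ht⟩
      exact ⟨world G m v hw, ⟨hm, rfl⟩, ht⟩
  truth_dia1 {n v} h k := by
    simp only [ofCode_dia1, TwoFrame.Truth, h, exists_true_left]
    constructor
    · rintro ⟨⟨⟨m, _⟩, ⟨w, hw⟩⟩, ⟨hr, he⟩, ht⟩
      obtain rfl : n = m := congrArg Subtype.val he
      exact ⟨w, hw, Ne.symm ((hdiff _ v h w hw).1 hr), hw, ht⟩
    · rintro ⟨w, -, hne, hw, ht⟩
      exact ⟨world G n w hw, ⟨(hdiff _ v h w hw).2 hne.symm, rfl⟩, ht⟩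

end

theorem not_certifies_of_satisfiable {φ : Formula}
    (h : Satisfiable (expandingProduct {⟨ℕ, omegaFrame⟩} diffFrames.{u}) φ)
    (C : List (ℕ × List ℕ)) : ¬ Certifies φ.toNat C := by
  obtain ⟨H, ⟨U, V, F, G, hG, hF, hdiff, rfl⟩, ν, w, hw⟩ := h
  cases hF
  obtain ⟨⟨n, _⟩, ⟨v, hv⟩⟩ := w
  refine (ofFrame G hG hdiff ν).not_certifies (n := n) (v := v) hv ⟨hv, ?_⟩ C
  rw [ofCode_eq rfl]
  exact hw

namespace Run

variable {M : ℕ} (𝔯 : Run M)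

/-- The difference frame on the points that exist at time `n`. -/
def frame (h0 : 0 < (𝔯.state 0).length) (n : ℕ) : Frame (ULift.{u} ℕ) where
  carrier := {v | v.down < (𝔯.state n).length}
  nonempty := ⟨⟨0⟩, h0.trans_le (𝔯.length_mono n.zero_le)⟩
  rel x y := x ≠ y ∧ x.down < (𝔯.state n).length ∧ y.down < (𝔯.state n).length
  rel_mem _ _ h := h.2

/-- The valuation read off the labels of a run. -/
def val (h0 : 0 < (𝔯.state 0).length) :
    (frameSum omegaFrame fun n => 𝔯.frame.{u} h0 n).Valuation :=
  fun p => {w | Holds (𝔯.lab w.1 w.2.1.down) (5 * p)}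

/-- A compound formula with code below `5 * M` has immediate subformulas with codes below `M`, the
range in which coherence and moves constrain labels. -/
theorem truth_iff (h0 : 0 < (𝔯.state 0).length) (ψ : Formula) (hψ : ψ.toNat < 5 * M)
    (w : (frameSum omegaFrame fun n => 𝔯.frame.{u} h0 n).World) :
    (frameSum omegaFrame fun n => 𝔯.frame.{u} h0 n).Truth (𝔯.val h0) w ψ ↔
      Holds (𝔯.lab w.1 w.2.1.down) ψ.toNat := by
  induction ψ generalizing w with
  | var p => exact Iff.rfl
  | neg ψ ih =>
    simp only [Formula.toNat] at hψ ⊢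
    rw [𝔯.holds_neg_iff w.2.2 (by omega), ← ih (by omega)]
    exact Iff.rfl
  | and ψ χ ih1 ih2 =>
    simp only [Formula.toNat] at hψ ⊢
    have h1 := Nat.left_le_pair ψ.toNat χ.toNat
    have h2 := Nat.right_le_pair ψ.toNat χ.toNat
    rw [𝔯.holds_and_iff w.2.2 (by omega), Nat.unpair_pair, ← ih1 (by omega), ← ih2 (by omega)]
    exact Iff.rfl
  | dia0 ψ ih =>
    simp only [Formula.toNat] at hψ ⊢
    rw [𝔯.holds_dia0_iff w.2.2 (by omega)]
    constructor
    · rintro ⟨w', ⟨hr, he⟩, ht⟩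
      refine ⟨w'.1, hr, ?_⟩
      rw [he]
      exact (ih (by omega) w').1 ht
    · rintro ⟨m, hm, ht⟩
      exact ⟨⟨⟨m, trivial⟩, ⟨w.2.1, w.2.2.trans_le (𝔯.length_mono hm.le)⟩⟩, ⟨hm, rfl⟩,
        (ih (by omega) _).2 ht⟩
  | dia1 ψ ih =>
    simp only [Formula.toNat] at hψ ⊢
    rw [𝔯.holds_dia1_iff w.2.2 (by omega)]
    constructor
    · rintro ⟨w', ⟨hr, he⟩, ht⟩
      refine ⟨w'.2.1.down, hr.2.2, fun h => hr.1 (ULift.down_injective h.symm), ?_⟩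
      rw [he]
      exact (ih (by omega) w').1 ht
    · rintro ⟨j, hj, hne, ht⟩
      exact ⟨⟨w.1, ⟨⟨j⟩, hj⟩⟩, ⟨⟨fun h => hne (congrArg ULift.down h).symm, w.2.2, hj⟩, rfl⟩,
        (ih (by omega) _).2 ht⟩

/-- Points are positions, present from the first time at which the list is long enough; `ULift`
places them in the required universe. -/
theorem satisfiable {φ : Formula} (𝔯 : Run (φ.toNat + 1))
    (h : ∃ a ∈ 𝔯.state 0, Holds a φ.toNat) :
    Satisfiable (expandingProduct {⟨ℕ, omegaFrame⟩} diffFrames.{u}) φ := by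
  obtain ⟨a, ha, hφ⟩ := h
  obtain ⟨i, hi, rfl⟩ := List.getElem_of_mem ha
  have h0 : 0 < (𝔯.state 0).length := by omega
  refine ⟨frameSum omegaFrame fun n => 𝔯.frame.{u} h0 n,
    ⟨ℕ, ULift.{u} ℕ, omegaFrame, fun n => 𝔯.frame.{u} h0 n, ?_, rfl, ?_, rfl⟩, 𝔯.val h0,
    ⟨⟨0, trivial⟩, ⟨⟨i⟩, hi⟩⟩, ?_⟩
  · intro x y hxy
    have hle := 𝔯.length_mono (le_of_lt hxy)
    refine ⟨fun v hv => lt_of_lt_of_le hv hle, fun v w => ⟨fun h => ?_, fun h => ?_⟩⟩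
    · exact ⟨⟨h.1, h.2.1.trans_le hle, h.2.2.trans_le hle⟩, h.2⟩
    · exact ⟨h.1.1, h.2⟩
  · intro n x hx y hy
    exact ⟨fun h => h.1, fun h => ⟨h, hx, hy⟩⟩
  · refine (𝔯.truth_iff h0 φ (by omega) _).2 ?_
    simpa only [lab, List.getD_eq_getElem _ _ hi] using hφ

end Run

end Sat

end Bimodal

theorem theorem8 :
    Bimodal.CoREPred
      (Bimodal.Satisfiable
        (Bimodal.expandingProduct {⟨ℕ, Bimodal.omegaFrame⟩} Bimodal.diffFrames.{u})) := by
  refine Bimodal.Sat.rePred_exists_certifies.of_eq fun φ => ⟨?_, fun h => ?_⟩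
  · rintro ⟨C, hC⟩ h
    exact Bimodal.Sat.not_certifies_of_satisfiable h C hC
  · exact Bimodal.Sat.exists_certifies fun ⟨𝔯, h𝔯⟩ => h (𝔯.satisfiable h𝔯)
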